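/- For a finite abelian group $Z$, an integer $s\ge 1$ and a function $f\colon Z\to\mathbb{R}$, let $$\|f\|_{U^s(Z)}=\Big(\frac{1}{|Z|^{s+1}}\sum_{x\in Z}\ \sum_{(h_1,\dots,h_s)\in Z^s}\ \prod_{\omega\in\{0,1\}^s} f(x+\omega_1h_1+\cdots+\omega_sh_s)\Big)^{1/2^s}$$ be the Gowers uniformity norm of $f$. Let $s\ge 2$ be an integer. Then there is a function $F_s$ of $\eta$, depending only on $s$, with $F_s(\eta)\to 0$ as $\eta\to 0^+$, such that the following holds. Let $Z$ be a finite abelian group, let $0<\eta\le 1$, and let $\nu\colon Z\to[0,\infty)$ satisfy $\|\nu-1\|_{U^{2s}(Z)}\le\eta$. Then for every $f\colon Z\to\mathbb{R}$ with $|f|\le\nu$ there exists $h\colon Z\to[-1,1]$ such that $$\|f-h\|_{U^s(Z)}\le F_s(\eta).$$ Moreover, if $f$ is nonnegative, then $h$ can be taken nonnegative. -/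

import Mathlib

open Filter Topology
open scoped BigOperators

/-- The Gowers uniformity norm `‖f‖_{U^s(Z)}` of a real-valued function `f` on a finite abelian
group `Z`: the `2^s`-th root of the average over `x ∈ Z` and `h ∈ Z^s` of the product, over all
`ω ∈ {0,1}^s`, of the values `f (x + ∑ i, ω i • h i)`. -/
noncomputable def gowersNorm {Z : Type*} [AddCommGroup Z] [Fintype Z] (s : ℕ) (f : Z → ℝ) : ℝ :=
  (𝔼 p : Z × (Fin s → Z), ∏ ω : Fin s → Fin 2, f (p.1 + ∑ i, (ω i : ℕ) • p.2 i))
    ^ ((1 : ℝ) / 2 ^ s)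

/-!
By minimax, some bounded `h` pairs almost like `f` with every convex combination of cut functions,
because the extremal values of both pairings differ only by an average against `ν - 1`, which is
small on such combinations. Dual functions of cubes with bounded entries are convex combinations of
cut functions, so `f - h` is negligible next to bounded entries. In the cube form all of whose
entries are `f - h`, the entries that are only bounded by a multiple of `ν + 1` are then replaced
by bounded ones, one at a time: by the Cauchy–Schwarz inequality such an entry can be traded for its
own dual function, and dual functions can be truncated, because two `s`-dimensional cubes glued
along a vertex lie in a `2s`-dimensional cube, on which `ν` behaves like `1`.
-/

section BoxForm

open Finset Function

variable {κ X : Type*}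

/-- The vertex `ω` of the box `∏ i, {z i, y i}`. -/
def boxVertex (ω : κ → Fin 2) (z y : κ → X) : κ → X := fun i => if ω i = 0 then z i else y i

variable [DecidableEq κ]

theorem boxVertex_update (ω : κ → Fin 2) (z y : κ → X) (i : κ) (a b : X) :
    boxVertex ω (update z i a) (update y i b) =
      update (boxVertex ω z y) i (if ω i = 0 then a else b) := by
  funext j
  rcases eq_or_ne j i with rfl | h
  · simp [boxVertex]
  · simp [boxVertex, h]

theorem update_boxVertex_update (ω : κ → Fin 2) (z y : κ → X) (i : κ) (c : Fin 2) (a : X) :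
    update (boxVertex (update ω i c) z y) i a = update (boxVertex ω z y) i a := by
  funext j
  rcases eq_or_ne j i with rfl | h
  · simp
  · simp [boxVertex, h]

variable [Fintype κ]

theorem prod_cube_eq_prod_edges {M : Type*} [CommMonoid M] (H : (κ → Fin 2) → M) (i : κ) :
    ∏ ω, H ω = ∏ ω with ω i = 0, H (update ω i 0) * H (update ω i 1) := by
  have hface : ∏ ω with ω i ≠ 0, H ω = ∏ ω with ω i = 0, H (update ω i 1) := by
    refine prod_nbij' (fun ω => update ω i 0) (fun ω => update ω i 1) (by simp) (by simp)
      (fun ω hω => ?_) (fun ω hω => ?_) (fun ω hω => ?_)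
    · simp [← Fin.eq_one_of_ne_zero _ (mem_filter.1 hω).2]
    · simp [← (mem_filter.1 hω).2]
    · simp [← Fin.eq_one_of_ne_zero _ (mem_filter.1 hω).2]
  rw [← prod_filter_mul_prod_filter_not univ (fun ω : κ → Fin 2 => ω i = 0), hface,
    prod_mul_distrib]
  congr 1
  refine prod_congr rfl fun ω hω => ?_
  rw [← (mem_filter.1 hω).2, update_eq_self]

theorem prod_le_prod_of_sq_le_mul_edge {A B : (κ → Fin 2) → ℝ} (hB : ∀ σ, 0 ≤ B σ) (i : κ)
    (h : ∀ σ, A σ ^ 2 ≤ B (update σ i 0) * B (update σ i 1)) : ∏ σ, A σ ≤ ∏ σ, B σ := by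
  refine le_of_sq_le_sq ?_ (prod_nonneg fun σ _ => hB σ)
  calc (∏ σ, A σ) ^ 2 = ∏ σ, A σ ^ 2 := (prod_pow _ _ _).symm
    _ ≤ ∏ σ, B (update σ i 0) * B (update σ i 1) :=
        prod_le_prod (fun σ _ => sq_nonneg _) fun σ _ => h σ
    _ = (∏ σ, B σ) ^ 2 := by
        rw [prod_cube_eq_prod_edges _ i, prod_cube_eq_prod_edges B i, sq, ← prod_mul_distrib]
        simp only [update_idem]

variable [Fintype X]

/-- The multilinear form underlying the box norms. -/
noncomputable def boxForm (F : (κ → Fin 2) → (κ → X) → ℝ) : ℝ :=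
  𝔼 z : κ → X, 𝔼 y : κ → X, ∏ ω, F ω (boxVertex ω z y)

/-- The contribution of the face `ω i = c` to the box form, averaged over the `i`-th coordinate of
that face; the box is spanned by `p.1` and `p.2`. -/
noncomputable def faceAvg (F : (κ → Fin 2) → (κ → X) → ℝ) (i : κ) (c : Fin 2)
    (p : (κ → X) × (κ → X)) : ℝ :=
  𝔼 a, ∏ ω with ω i = 0, F (update ω i c) (update (boxVertex ω p.1 p.2) i a)

theorem faceAvg_comp_update (F : (κ → Fin 2) → (κ → X) → ℝ) (i : κ) (c c' : Fin 2) :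
    faceAvg (fun ω => F (update ω i c)) i c' = faceAvg F i c := by
  funext p
  simp only [faceAvg, update_idem]

theorem expect_expect_update (g : (κ → X) → ℝ) (i : κ) :
    𝔼 z : κ → X, 𝔼 a, g (update z i a) = 𝔼 z, g z := by
  rcases isEmpty_or_nonempty X with hX | hX
  · have : IsEmpty (κ → X) := ⟨fun z => hX.elim (z i)⟩
    simp
  have swap : Involutive fun p : (κ → X) × X => (update p.1 i p.2, p.1 i) := by
    rintro ⟨z, a⟩
    simp
  calc 𝔼 z : κ → X, 𝔼 a, g (update z i a) = 𝔼 p : (κ → X) × X, g (update p.1 i p.2) := by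
        rw [← univ_product_univ, expect_product]
    _ = 𝔼 p : (κ → X) × X, g p.1 := Fintype.expect_equiv swap.toPerm _ _ fun _ => rfl
    _ = 𝔼 z, g z := by
        rw [← univ_product_univ, expect_product]
        simp only [Fintype.expect_const]

theorem boxForm_eq_expect_faceAvg (F : (κ → Fin 2) → (κ → X) → ℝ) (i : κ) :
    boxForm F = 𝔼 p, faceAvg F i 0 p * faceAvg F i 1 p := by
  rw [← univ_product_univ, expect_product, boxForm, ← expect_expect_update _ i]
  refine expect_congr rfl fun z _ => ?_
  simp only [fun a : X => (expect_expect_update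
    (fun y => ∏ ω, F ω (boxVertex ω (update z i a) y)) i).symm]
  rw [expect_comm]
  refine expect_congr rfl fun y _ => ?_
  rw [faceAvg, faceAvg, Fintype.expect_mul_expect]
  refine expect_congr rfl fun a _ => expect_congr rfl fun b _ => ?_
  rw [prod_cube_eq_prod_edges _ i, ← prod_mul_distrib]
  simp [boxVertex_update, update_boxVertex_update]

theorem boxForm_sq_le (F : (κ → Fin 2) → (κ → X) → ℝ) (i : κ) :
    boxForm F ^ 2 ≤
      boxForm (fun ω => F (update ω i 0)) * boxForm (fun ω => F (update ω i 1)) := by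
  simp only [boxForm_eq_expect_faceAvg _ i, faceAvg_comp_update, ← sq]
  exact expect_mul_sq_le_sq_mul_sq _ _ _

theorem boxForm_const_nonneg [Nonempty κ] (G : (κ → X) → ℝ) :
    0 ≤ boxForm (fun _ : κ → Fin 2 => G) := by
  obtain ⟨i⟩ := ‹Nonempty κ›
  rw [boxForm_eq_expect_faceAvg _ i]
  exact expect_nonneg fun p _ => mul_self_nonneg _

theorem abs_boxForm_pow_le (F : (κ → Fin 2) → (κ → X) → ℝ) :
    |boxForm F| ^ Fintype.card (κ → Fin 2) ≤ ∏ σ, |boxForm (fun _ : κ → Fin 2 => F σ)| := by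
  -- Gowers–Cauchy–Schwarz: the coordinates of the vertices are frozen one at a time.
  have freeze : ∀ J : Finset κ, |boxForm F| ^ Fintype.card (κ → Fin 2) ≤
      ∏ σ : κ → Fin 2, |boxForm (fun ω => F (J.piecewise σ ω))| := by
    intro J
    induction J using Finset.induction_on with
    | empty => simp
    | insert i J hi ih =>
      refine ih.trans (prod_le_prod_of_sq_le_mul_edge (fun _ => abs_nonneg _) i fun σ => ?_)
      have freeze_insert (c : Fin 2) (ω : κ → Fin 2) :
          J.piecewise σ (update ω i c) = (insert i J).piecewise (update σ i c) ω := by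
        funext j
        rcases eq_or_ne j i with rfl | hj
        · simp [hi]
        · simp [Finset.piecewise, hj]
      rw [sq_abs, ← abs_mul]
      refine ((boxForm_sq_le _ i).trans_eq ?_).trans (le_abs_self _)
      simp only [freeze_insert]
  simpa using freeze univ

theorem abs_boxForm_le_one {F : (κ → Fin 2) → (κ → X) → ℝ} (hF : ∀ ω z, |F ω z| ≤ 1) :
    |boxForm F| ≤ 1 := by
  rcases isEmpty_or_nonempty (κ → X) with hX | hX
  · simp [boxForm]
  refine (abs_expect_le _ _).trans (expect_le univ_nonempty fun z _ => ?_)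
  refine (abs_expect_le _ _).trans (expect_le univ_nonempty fun y _ => ?_)
  rw [abs_prod]
  exact prod_le_one (fun _ _ => abs_nonneg _) fun ω _ => hF ω _

theorem abs_boxForm_pow_le_of_abs_le_one {F : (κ → Fin 2) → (κ → X) → ℝ} {v : κ → Fin 2}
    (hF : ∀ ω ≠ v, ∀ z, |F ω z| ≤ 1) :
    |boxForm F| ^ Fintype.card (κ → Fin 2) ≤ |boxForm (fun _ : κ → Fin 2 => F v)| := by
  refine (abs_boxForm_pow_le F).trans ?_
  rw [← mul_prod_erase _ _ (mem_univ v)]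
  exact mul_le_of_le_one_right (abs_nonneg _) (prod_le_one (fun _ _ => abs_nonneg _)
    fun ω hω => abs_boxForm_le_one fun _ => hF ω (ne_of_mem_erase hω))

end BoxForm

section CubeForm

open Finset Function

variable {κ Z : Type*} [Fintype κ] [AddCommGroup Z]

/-- The displacement from the base point of the vertex `ω` of the cube with edges `h`. -/
def cubePoint (ω : κ → Fin 2) (h : κ → Z) : Z := ∑ i, (ω i : ℕ) • h i

theorem sum_boxVertex_add (ω : κ → Fin 2) (z h : κ → Z) :
    ∑ i, boxVertex ω z (z + h) i = ∑ i, z i + cubePoint ω h := by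
  rw [cubePoint, ← sum_add_distrib]
  refine sum_congr rfl fun i _ => ?_
  obtain h0 | h0 : ω i = 0 ∨ ω i = 1 := by omega
  all_goals simp [boxVertex, h0]

variable [DecidableEq κ] [Fintype Z]

/-- The multilinear form underlying the Gowers norms, on the cubes with edges indexed by `κ`. -/
noncomputable def cubeForm (f : (κ → Fin 2) → Z → ℝ) : ℝ :=
  𝔼 x : Z, 𝔼 h : κ → Z, ∏ ω, f ω (x + cubePoint ω h)

variable (κ) in
/-- The Gowers norm for cubes with edges indexed by `κ`, so that `U^s` is the case `κ = Fin s`;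
arbitrary index types allow two cubes to be joined along a vertex. -/
noncomputable def cubeNorm (g : Z → ℝ) : ℝ :=
  cubeForm (fun _ : κ → Fin 2 => g) ^ (Fintype.card (κ → Fin 2) : ℝ)⁻¹

theorem abs_cubeForm_le_cubeForm {f m : (κ → Fin 2) → Z → ℝ} (h : ∀ ω x, |f ω x| ≤ m ω x) :
    |cubeForm f| ≤ cubeForm m := by
  refine (abs_expect_le _ _).trans (expect_le_expect fun x _ => ?_)
  refine (abs_expect_le _ _).trans (expect_le_expect fun y _ => ?_)
  rw [abs_prod]
  exact prod_le_prod (fun _ _ => abs_nonneg _) fun ω _ => h ω _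

theorem cubeForm_one : cubeForm (1 : (κ → Fin 2) → Z → ℝ) = 1 := by
  simp [cubeForm]

theorem cubeNorm_one : cubeNorm κ (1 : Z → ℝ) = 1 := by
  rw [cubeNorm]
  exact (congrArg (· ^ _) cubeForm_one).trans (Real.one_rpow _)

theorem cubeForm_add (f g : (κ → Fin 2) → Z → ℝ) :
    cubeForm (f + g) = ∑ t : Finset (κ → Fin 2), cubeForm (t.piecewise f g) := by
  simp only [cubeForm, ← expect_sum_comm]
  refine expect_congr rfl fun x _ => expect_congr rfl fun h _ => ?_
  simp only [Pi.add_apply]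
  rw [Fintype.prod_add]
  refine sum_congr rfl fun t _ => ?_
  rw [← prod_mul_prod_compl t]
  congr 1
  · exact prod_congr rfl fun ω hω => by rw [piecewise_eq_of_mem _ _ _ hω]
  · exact prod_congr rfl fun ω hω => by rw [piecewise_eq_of_notMem _ _ _ (mem_compl.1 hω)]

variable (κ) in
/-- The error in the linear forms condition for functions whose Gowers distance to `1` is at most
`η`. -/
noncomputable def linearFormsError (η : ℝ) : ℝ := (1 + η) ^ Fintype.card (κ → Fin 2) - 1

theorem le_linearFormsError {η : ℝ} (hη : 0 ≤ η) : η ≤ linearFormsError κ η := by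
  have := le_self_pow₀ (by linarith : 1 ≤ 1 + η) (Fintype.card_ne_zero (α := κ → Fin 2))
  rw [linearFormsError]
  linarith

variable [Nonempty κ]

theorem expect_comp_sum (Ψ : Z → ℝ) : 𝔼 z : κ → Z, Ψ (∑ i, z i) = 𝔼 x, Ψ x := by
  obtain ⟨i⟩ := ‹Nonempty κ›
  rw [← expect_expect_update _ i]
  have translate (z : κ → Z) : 𝔼 a, Ψ (∑ j, update z i a j) = 𝔼 x, Ψ x := by
    refine Fintype.expect_equiv (Equiv.addRight (∑ j ∈ univ \ {i}, z j)) _ _ fun a => ?_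
    rw [sum_update_of_mem (mem_univ i), Equiv.coe_addRight]
  simp only [translate, Fintype.expect_const]

theorem boxForm_comp_sum (f : (κ → Fin 2) → Z → ℝ) :
    boxForm (fun ω (z : κ → Z) => f ω (∑ i, z i)) = cubeForm f := by
  rw [cubeForm, ← expect_comp_sum (κ := κ)]
  refine expect_congr rfl fun z _ => ?_
  refine (Fintype.expect_equiv (Equiv.addLeft z) _ _ fun h => ?_).symm
  simp only [Equiv.coe_addLeft, sum_boxVertex_add]

theorem cubeForm_const_nonneg (g : Z → ℝ) : 0 ≤ cubeForm (fun _ : κ → Fin 2 => g) := by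
  rw [← boxForm_comp_sum]
  exact boxForm_const_nonneg _

theorem cubeNorm_nonneg (g : Z → ℝ) : 0 ≤ cubeNorm κ g :=
  Real.rpow_nonneg (cubeForm_const_nonneg g) _

theorem cubeNorm_pow_card (g : Z → ℝ) :
    cubeNorm κ g ^ Fintype.card (κ → Fin 2) = cubeForm (fun _ : κ → Fin 2 => g) :=
  Real.rpow_inv_natCast_pow (cubeForm_const_nonneg g) Fintype.card_ne_zero

theorem cubeNorm_mono {g m : Z → ℝ} (h : ∀ x, |g x| ≤ m x) : cubeNorm κ g ≤ cubeNorm κ m :=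
  Real.rpow_le_rpow (cubeForm_const_nonneg g)
    ((le_abs_self _).trans (abs_cubeForm_le_cubeForm fun _ => h)) (by positivity)

theorem cubeNorm_smul (c : ℝ) (g : Z → ℝ) : cubeNorm κ (c • g) = |c| * cubeNorm κ g := by
  have hform : cubeForm (fun _ : κ → Fin 2 => c • g) =
      |c| ^ Fintype.card (κ → Fin 2) * cubeForm (fun _ : κ → Fin 2 => g) := by
    have heven : Even (Fintype.card (κ → Fin 2)) := by simp [Nat.even_pow]
    simp only [cubeForm, Pi.smul_apply, smul_eq_mul, prod_mul_distrib, prod_const, mul_expect,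
      card_univ, heven.pow_abs]
  rw [cubeNorm, hform, Real.mul_rpow (by positivity) (cubeForm_const_nonneg g),
    Real.pow_rpow_inv_natCast (abs_nonneg c) Fintype.card_ne_zero, cubeNorm]

theorem cubeNorm_zero : cubeNorm κ (0 : Z → ℝ) = 0 := by
  simpa using cubeNorm_smul (κ := κ) 0 (0 : Z → ℝ)

theorem abs_cubeForm_le_prod_cubeNorm (f : (κ → Fin 2) → Z → ℝ) :
    |cubeForm f| ≤ ∏ ω, cubeNorm κ (f ω) := by
  refine le_of_pow_le_pow_left₀ (n := Fintype.card (κ → Fin 2)) Fintype.card_ne_zero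
    (prod_nonneg fun ω _ => cubeNorm_nonneg _) ?_
  rw [← prod_pow, ← boxForm_comp_sum]
  refine (abs_boxForm_pow_le _).trans_eq (prod_congr rfl fun ω _ => ?_)
  rw [boxForm_comp_sum fun _ => f ω, abs_of_nonneg (cubeForm_const_nonneg _), cubeNorm_pow_card]

theorem abs_cubeForm_piecewise_le {f g : (κ → Fin 2) → Z → ℝ} {a b : ℝ}
    (hf : ∀ ω, cubeNorm κ (f ω) ≤ a) (hg : ∀ ω, cubeNorm κ (g ω) ≤ b) (t : Finset (κ → Fin 2)) :
    |cubeForm (t.piecewise f g)| ≤ a ^ #t * b ^ (Fintype.card (κ → Fin 2) - #t) := by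
  calc |cubeForm (t.piecewise f g)| ≤ ∏ ω, cubeNorm κ (t.piecewise f g ω) :=
        abs_cubeForm_le_prod_cubeNorm _
    _ ≤ ∏ ω, t.piecewise (fun _ => a) (fun _ => b) ω :=
        prod_le_prod (fun ω _ => cubeNorm_nonneg _) fun ω _ => by
          by_cases hω : ω ∈ t <;> simp [hω, hf, hg]
    _ = a ^ #t * b ^ (Fintype.card (κ → Fin 2) - #t) := by
        rw [prod_piecewise, univ_inter, prod_const, prod_const,
          card_sdiff_of_subset (subset_univ t), card_univ]

theorem cubeNorm_add_le (f g : Z → ℝ) : cubeNorm κ (f + g) ≤ cubeNorm κ f + cubeNorm κ g := by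
  refine le_of_pow_le_pow_left₀ (n := Fintype.card (κ → Fin 2)) Fintype.card_ne_zero
    (add_nonneg (cubeNorm_nonneg f) (cubeNorm_nonneg g)) ?_
  calc cubeNorm κ (f + g) ^ Fintype.card (κ → Fin 2)
      = ∑ t : Finset (κ → Fin 2), cubeForm (t.piecewise (fun _ => f) fun _ => g) := by
        rw [cubeNorm_pow_card, ← cubeForm_add]; rfl
    _ ≤ ∑ t : Finset (κ → Fin 2),
          cubeNorm κ f ^ #t * cubeNorm κ g ^ (Fintype.card (κ → Fin 2) - #t) :=
        sum_le_sum fun t _ => (le_abs_self _).trans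
          (abs_cubeForm_piecewise_le (fun _ => le_rfl) (fun _ => le_rfl) t)
    _ = (cubeNorm κ f + cubeNorm κ g) ^ Fintype.card (κ → Fin 2) :=
        Fintype.sum_pow_mul_eq_add_pow _ _ _

theorem abs_cubeForm_sub_one_le {m : (κ → Fin 2) → Z → ℝ} {η : ℝ}
    (hm : ∀ ω, cubeNorm κ (m ω - 1) ≤ η) : |cubeForm m - 1| ≤ linearFormsError κ η := by
  have hdiff (ω : κ → Fin 2) : cubeNorm κ ((m - 1) ω) ≤ η := hm ω
  have hone (ω : κ → Fin 2) : cubeNorm κ ((1 : (κ → Fin 2) → Z → ℝ) ω) ≤ 1 := cubeNorm_one.le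
  have hempty : cubeForm ((∅ : Finset (κ → Fin 2)).piecewise (m - 1) 1) = 1 := by
    rw [piecewise_empty, cubeForm_one]
  have expand : cubeForm m - 1 =
      ∑ t ∈ univ.erase (∅ : Finset (κ → Fin 2)), cubeForm (t.piecewise (m - 1) 1) := by
    rw [sum_erase_eq_sub (mem_univ _), ← cubeForm_add, sub_add_cancel, hempty]
  calc |cubeForm m - 1|
      ≤ ∑ t ∈ univ.erase (∅ : Finset (κ → Fin 2)), |cubeForm (t.piecewise (m - 1) 1)| := by
        rw [expand]; exact abs_sum_le_sum_abs _ _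
    _ ≤ ∑ t ∈ univ.erase (∅ : Finset (κ → Fin 2)),
          η ^ #t * 1 ^ (Fintype.card (κ → Fin 2) - #t) :=
        sum_le_sum fun t _ => abs_cubeForm_piecewise_le hdiff hone t
    _ = linearFormsError κ η := by
        rw [sum_erase_eq_sub (mem_univ _), Fintype.sum_pow_mul_eq_add_pow, card_empty, pow_zero,
          one_pow, one_mul, linearFormsError, add_comm]

theorem cubeNorm_le_one_add_of_abs_le {f m : Z → ℝ} (h : ∀ x, |f x| ≤ m x) :
    cubeNorm κ f ≤ 1 + cubeNorm κ (m - 1) :=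
  calc cubeNorm κ f ≤ cubeNorm κ (1 + (m - 1)) := by
        rw [add_sub_cancel]; exact cubeNorm_mono h
    _ ≤ 1 + cubeNorm κ (m - 1) := by
        simpa only [cubeNorm_one] using cubeNorm_add_le (κ := κ) 1 (m - 1)

end CubeForm

section CubeDual

open Finset Function

variable {κ Z : Type*} [Fintype κ] [AddCommGroup Z] [DecidableEq κ] [Fintype Z]

/-- The dual function of the family `f` at the vertex `v`: the average of the product of `f` over
the other vertices of the cubes whose vertex `v` is `x`. -/
noncomputable def cubeDual (f : (κ → Fin 2) → Z → ℝ) (v : κ → Fin 2) (x : Z) : ℝ :=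
  𝔼 h : κ → Z, ∏ ω ∈ univ.erase v, f ω (x + (cubePoint ω h - cubePoint v h))

theorem abs_cubeDual_le_cubeDual {f m : (κ → Fin 2) → Z → ℝ} {v : κ → Fin 2}
    (h : ∀ ω ≠ v, ∀ x, |f ω x| ≤ m ω x) (x : Z) : |cubeDual f v x| ≤ cubeDual m v x := by
  refine (abs_expect_le _ _).trans (expect_le_expect fun y _ => ?_)
  rw [abs_prod]
  exact prod_le_prod (fun _ _ => abs_nonneg _) fun ω hω => h ω (ne_of_mem_erase hω) _

theorem cubeDual_one (v : κ → Fin 2) : cubeDual (1 : (κ → Fin 2) → Z → ℝ) v = 1 := by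
  funext x
  simp [cubeDual]

theorem cubeDual_update (f : (κ → Fin 2) → Z → ℝ) (v : κ → Fin 2) (w : Z → ℝ) :
    cubeDual (update f v w) v = cubeDual f v := by
  funext x
  refine expect_congr rfl fun h _ => prod_congr rfl fun ω hω => ?_
  rw [update_of_ne (ne_of_mem_erase hω)]

theorem cubeForm_eq_expect_sub (f : (κ → Fin 2) → Z → ℝ) (v : κ → Fin 2) :
    cubeForm f = 𝔼 x : Z, 𝔼 h : κ → Z, ∏ ω, f ω (x + (cubePoint ω h - cubePoint v h)) := by
  rw [cubeForm, expect_comm, expect_comm (s := univ (α := Z))]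
  refine expect_congr rfl fun h _ => ?_
  refine Fintype.expect_equiv (Equiv.addRight (cubePoint v h)) _ _ fun x => ?_
  simp only [Equiv.coe_addRight, add_assoc, add_sub_cancel]

theorem cubeForm_eq_expect_mul_cubeDual (f : (κ → Fin 2) → Z → ℝ) (v : κ → Fin 2) :
    cubeForm f = 𝔼 x, f v x * cubeDual f v x := by
  rw [cubeForm_eq_expect_sub f v]
  refine expect_congr rfl fun x _ => ?_
  rw [cubeDual, mul_expect]
  refine expect_congr rfl fun h _ => ?_
  rw [← mul_prod_erase _ _ (mem_univ v), sub_self, add_zero]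

theorem cubeForm_update (f : (κ → Fin 2) → Z → ℝ) (v : κ → Fin 2) (w : Z → ℝ) :
    cubeForm (update f v w) = 𝔼 x, w x * cubeDual f v x := by
  rw [cubeForm_eq_expect_mul_cubeDual _ v, cubeDual_update, update_self]

end CubeDual

section GlueFaces

open Finset Function

variable {ι κ Z : Type*} {v : ι → Fin 2} {v' : κ → Fin 2}

open Classical in
/-- The family on the cube over `ι ⊕ κ` that carries `f` and `f'` on the two faces through the
vertex `(v, v')` given by `ι` and `κ`, carries `w` at that vertex, and is `1` off the faces. -/
noncomputable def glueFaces (v : ι → Fin 2) (v' : κ → Fin 2) (w : Z → ℝ)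
    (f : (ι → Fin 2) → Z → ℝ) (f' : (κ → Fin 2) → Z → ℝ) (ω : ι ⊕ κ → Fin 2) : Z → ℝ :=
  if ω ∘ Sum.inl = v then if ω ∘ Sum.inr = v' then w else f' (ω ∘ Sum.inr)
  else if ω ∘ Sum.inr = v' then f (ω ∘ Sum.inl) else 1

theorem glueFaces_cases {p : (Z → ℝ) → Prop} {w : Z → ℝ} {f : (ι → Fin 2) → Z → ℝ}
    {f' : (κ → Fin 2) → Z → ℝ} (hw : p w) (hf : ∀ ω, p (f ω)) (hf' : ∀ ω, p (f' ω)) (h1 : p 1)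
    (ω : ι ⊕ κ → Fin 2) : p (glueFaces v v' w f f' ω) := by
  unfold glueFaces
  split_ifs
  exacts [hw, hf' _, hf _, h1]

theorem cubePoint_sum [Fintype ι] [Fintype κ] [AddCommGroup Z] (ω : ι ⊕ κ → Fin 2)
    (h : ι ⊕ κ → Z) :
    cubePoint ω h = cubePoint (ω ∘ Sum.inl) (h ∘ Sum.inl) +
      cubePoint (ω ∘ Sum.inr) (h ∘ Sum.inr) := by
  simp [cubePoint]

theorem prod_glue {A B M : Type*} [Fintype A] [Fintype B] [DecidableEq A] [DecidableEq B]
    [CommMonoid M] (a₀ : A) (b₀ : B) (c : M) (a : A → M) (b : B → M) :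
    ∏ p : A × B, (if p.1 = a₀ then if p.2 = b₀ then c else b p.2
      else if p.2 = b₀ then a p.1 else 1) =
    c * ((∏ i ∈ univ.erase a₀, a i) * ∏ j ∈ univ.erase b₀, b j) := by
  have hrow : ∏ j, (if j = b₀ then c else b j) = c * ∏ j ∈ univ.erase b₀, b j := by
    rw [← mul_prod_erase univ _ (mem_univ b₀), if_pos rfl]
    exact congrArg (c * ·) (prod_congr rfl fun j hj => if_neg (ne_of_mem_erase hj))
  have hcol : ∏ i ∈ univ.erase a₀, ∏ j, (if i = a₀ then if j = b₀ then c else b j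
      else if j = b₀ then a i else 1) = ∏ i ∈ univ.erase a₀, a i :=
    prod_congr rfl fun i hi => by simp [ne_of_mem_erase hi]
  rw [Fintype.prod_prod_type, ← mul_prod_erase univ _ (mem_univ a₀), hcol]
  simp only [if_true]
  rw [hrow, mul_assoc, mul_comm (∏ j ∈ _, b j)]

variable [Fintype ι] [Fintype κ] [DecidableEq ι] [DecidableEq κ] [AddCommGroup Z] [Fintype Z]

theorem cubeForm_glueFaces (v : ι → Fin 2) (v' : κ → Fin 2) (w : Z → ℝ)
    (f : (ι → Fin 2) → Z → ℝ) (f' : (κ → Fin 2) → Z → ℝ) :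
    cubeForm (glueFaces v v' w f f') = 𝔼 x, w x * (cubeDual f v x * cubeDual f' v' x) := by
  rw [cubeForm_eq_expect_sub _ (Sum.elim v v')]
  refine expect_congr rfl fun x _ => ?_
  rw [cubeDual, cubeDual, Fintype.expect_mul_expect, ← expect_product', univ_product_univ,
    mul_expect]
  refine Fintype.expect_equiv (Equiv.sumArrowEquivProdArrow ι κ Z) _ _ fun h => ?_
  rw [← prod_glue]
  refine Fintype.prod_equiv (Equiv.sumArrowEquivProdArrow ι κ (Fin 2)) _ _ fun ω => ?_
  change glueFaces v v' w f f' ω _ = if ω ∘ Sum.inl = v then if ω ∘ Sum.inr = v' then w x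
    else f' (ω ∘ Sum.inr) (x + (cubePoint (ω ∘ Sum.inr) (h ∘ Sum.inr) -
      cubePoint v' (h ∘ Sum.inr)))
    else if ω ∘ Sum.inr = v' then f (ω ∘ Sum.inl)
      (x + (cubePoint (ω ∘ Sum.inl) (h ∘ Sum.inl) - cubePoint v (h ∘ Sum.inl))) else 1
  rw [cubePoint_sum ω, cubePoint_sum (Sum.elim v v'), Sum.elim_comp_inl, Sum.elim_comp_inr,
    glueFaces]
  split_ifs with h1 h2 h2 <;> simp [*]

theorem cubeNorm_le_cubeNorm_sum [Nonempty ι] (f : Z → ℝ) :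
    cubeNorm ι f ≤ cubeNorm (ι ⊕ κ) f := by
  refine le_of_pow_le_pow_left₀ (n := Fintype.card (ι → Fin 2)) Fintype.card_ne_zero
    (cubeNorm_nonneg f) ?_
  calc cubeNorm ι f ^ Fintype.card (ι → Fin 2)
      = cubeForm (glueFaces (0 : ι → Fin 2) (0 : κ → Fin 2) f (fun _ => f) 1) := by
        simp only [cubeForm_glueFaces, cubeDual_one, Pi.one_apply, mul_one, cubeNorm_pow_card,
          cubeForm_eq_expect_mul_cubeDual _ (0 : ι → Fin 2)]
    _ ≤ ∏ ω : ι ⊕ κ → Fin 2,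
          cubeNorm (ι ⊕ κ) (glueFaces (0 : ι → Fin 2) (0 : κ → Fin 2) f (fun _ => f) 1 ω) :=
        (le_abs_self _).trans (abs_cubeForm_le_prod_cubeNorm _)
    _ = ∏ p : (ι → Fin 2) × (κ → Fin 2), (if p.1 = 0
          then if p.2 = 0 then cubeNorm (ι ⊕ κ) f else 1
          else if p.2 = 0 then cubeNorm (ι ⊕ κ) f else 1) := by
        refine Fintype.prod_equiv (Equiv.sumArrowEquivProdArrow ι κ (Fin 2)) _ _ fun ω => ?_
        change _ = if ω ∘ Sum.inl = 0 then if ω ∘ Sum.inr = 0 then _ else _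
          else if ω ∘ Sum.inr = 0 then _ else _
        unfold glueFaces
        split_ifs <;> simp [cubeNorm_one]
    _ = cubeNorm (ι ⊕ κ) f ^ Fintype.card (ι → Fin 2) := by
        rw [prod_glue _ _ _ (fun _ => cubeNorm (ι ⊕ κ) f) (fun _ => 1), prod_const_one, mul_one,
          mul_prod_erase univ (fun _ => cubeNorm (ι ⊕ κ) f) (mem_univ 0), prod_const, card_univ]

end GlueFaces

section ConvexHull

open Finset

theorem expect_mem_of_convex {α Z : Type*} {C : Set (Z → ℝ)} (hC : Convex ℝ C) {s : Finset α}
    (hs : s.Nonempty) {f : α → Z → ℝ} (hf : ∀ a ∈ s, f a ∈ C) : 𝔼 a ∈ s, f a ∈ C := by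
  have hmem := hC.sum_mem (t := s) (w := fun _ => (#s : ℝ)⁻¹) (z := f) (fun _ _ => by positivity)
    (by simp [hs.card_pos.ne']) hf
  convert hmem using 1
  funext x
  simp [expect_eq_sum_div_card, div_eq_inv_mul, mul_sum]

theorem mul_mem_closedConvexHull {A : Type*} [Ring A] [Algebra ℝ A] [TopologicalSpace A]
    [IsTopologicalRing A] {S : Set A}
    (hS : ∀ a ∈ S, ∀ b ∈ S, a * b ∈ closedConvexHull ℝ S) {a b : A}
    (ha : a ∈ closedConvexHull ℝ S) (hb : b ∈ closedConvexHull ℝ S) :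
    a * b ∈ closedConvexHull ℝ S := by
  have hleft {c : A} (hc : c ∈ S) : closedConvexHull ℝ S ⊆ (c * ·) ⁻¹' closedConvexHull ℝ S :=
    closedConvexHull_min (hS c hc)
      (convex_closedConvexHull.is_linear_preimage (LinearMap.mulLeft ℝ c).isLinear)
      (isClosed_closedConvexHull.preimage (continuous_const_mul c))
  have hright : closedConvexHull ℝ S ⊆ (· * b) ⁻¹' closedConvexHull ℝ S :=
    closedConvexHull_min (fun c hc => hleft hc hb)
      (convex_closedConvexHull.is_linear_preimage (LinearMap.mulRight ℝ b).isLinear)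
      (isClosed_closedConvexHull.preimage (continuous_mul_const b))
  exact hright ha

theorem isLinearMap_expect_mul {Z : Type*} [Fintype Z] (g : Z → ℝ) :
    IsLinearMap ℝ (fun φ : Z → ℝ => 𝔼 x, g x * φ x) where
  map_add φ ψ := by simp [mul_add, expect_add_distrib]
  map_smul c φ := by simp [mul_expect, mul_left_comm]

theorem continuous_expect_mul {Z : Type*} [Fintype Z] (g : Z → ℝ) :
    Continuous (fun φ : Z → ℝ => 𝔼 x, g x * φ x) := by
  simp only [Fintype.expect_eq_sum_div_card]
  fun_prop

end ConvexHull

section SumFiber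

open Finset

variable {κ Z : Type*} [Fintype κ] [AddCommGroup Z] [DecidableEq κ] [Fintype Z]

open Classical in
variable (κ) in
/-- The vectors `z ∈ Z^κ` with coordinate sum `x`. -/
noncomputable def sumFiber (x : Z) : Finset (κ → Z) := {z | ∑ i, z i = x}

theorem mem_sumFiber {x : Z} {z : κ → Z} : z ∈ sumFiber κ x ↔ ∑ i, z i = x := by
  simp [sumFiber]

theorem expect_sumFiber_add {M : Type*} [AddCommMonoid M] [Module ℚ≥0 M] {x : Z} {z : κ → Z}
    (hz : z ∈ sumFiber κ x) (Ψ : (κ → Z) → M) :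
    𝔼 w ∈ sumFiber κ 0, Ψ (z + w) = 𝔼 z' ∈ sumFiber κ x, Ψ z' :=
  expect_equiv (Equiv.addLeft z)
    (fun w => by simp [mem_sumFiber, sum_add_distrib, mem_sumFiber.1 hz]) fun _ _ => rfl

variable [Nonempty κ]

theorem sumFiber_nonempty (x : Z) : (sumFiber κ x).Nonempty := by
  obtain ⟨i⟩ := ‹Nonempty κ›
  exact ⟨Pi.single i x, mem_sumFiber.2 (by simp)⟩

theorem expect_expect_sumFiber (Ψ : (κ → Z) → ℝ) :
    𝔼 x, 𝔼 z ∈ sumFiber κ x, Ψ z = 𝔼 z, Ψ z := by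
  have translate (w : κ → Z) : 𝔼 z, Ψ (z + w) = 𝔼 z, Ψ z :=
    Fintype.expect_equiv (Equiv.addRight w) _ _ fun _ => rfl
  calc 𝔼 x, 𝔼 z ∈ sumFiber κ x, Ψ z
      = 𝔼 z : κ → Z, 𝔼 z' ∈ sumFiber κ (∑ i, z i), Ψ z' := (expect_comp_sum _).symm
    _ = 𝔼 w ∈ sumFiber κ 0, 𝔼 z, Ψ (z + w) := by
        rw [expect_comm]
        exact expect_congr rfl fun z _ => (expect_sumFiber_add (mem_sumFiber.2 rfl) Ψ).symm
    _ = 𝔼 z, Ψ z := by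
        simp only [translate]
        exact expect_const (sumFiber_nonempty 0) _

end SumFiber

section CutFunctions

open Finset Function

variable {κ Z : Type*} [Fintype κ] [AddCommGroup Z]

/-- A family of bounded functions of `κ`-tuples, the `i`-th of which ignores coordinate `i`. -/
structure IsCutFamily {κ Z : Type*} (u : κ → (κ → Z) → ℝ) : Prop where
  abs_le_one : ∀ i z, |u i z| ≤ 1
  dependsOn : ∀ i, DependsOn (u i) {i}ᶜ

variable [DecidableEq κ] [Fintype Z]

/-- The cut function of the family `u`: these generate the functions that are structured with
respect to the Gowers norm `cubeNorm κ`. -/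
noncomputable def cutFun (u : κ → (κ → Z) → ℝ) (x : Z) : ℝ := 𝔼 z ∈ sumFiber κ x, ∏ i, u i z

variable (κ Z) in
/-- The closed convex hull of the cut functions of the families satisfying `IsCutFamily`. -/
noncomputable def cutHull : Set (Z → ℝ) :=
  closedConvexHull ℝ (cutFun '' {u : κ → (κ → Z) → ℝ | IsCutFamily u})

theorem cutFun_mem_cutHull {u : κ → (κ → Z) → ℝ} (hu : IsCutFamily u) :
    cutFun u ∈ cutHull κ Z :=
  subset_closedConvexHull ⟨u, hu, rfl⟩

theorem cutHull_subset {S : Set (Z → ℝ)} (hconv : Convex ℝ S) (hclosed : IsClosed S)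
    (h : ∀ u : κ → (κ → Z) → ℝ, IsCutFamily u → cutFun u ∈ S) : cutHull κ Z ⊆ S :=
  closedConvexHull_min (Set.image_subset_iff.2 h) hconv hclosed

theorem cutFun_mul_cutFun (u v : κ → (κ → Z) → ℝ) :
    cutFun u * cutFun v = 𝔼 w ∈ sumFiber κ 0, cutFun (fun i z => u i z * v i (z + w)) := by
  funext x
  simp only [Pi.mul_apply, expect_apply, cutFun, prod_mul_distrib]
  rw [expect_comm, expect_mul]
  refine expect_congr rfl fun z hz => ?_
  rw [← mul_expect, expect_sumFiber_add hz (fun z => ∏ i, v i z)]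

variable [Nonempty κ]

theorem expect_mul_cutFun (u : κ → (κ → Z) → ℝ) (g : Z → ℝ) :
    𝔼 x, g x * cutFun u x = 𝔼 z : κ → Z, g (∑ i, z i) * ∏ i, u i z := by
  rw [← expect_expect_sumFiber]
  refine expect_congr rfl fun x _ => ?_
  rw [cutFun, mul_expect]
  exact expect_congr rfl fun z hz => by rw [mem_sumFiber.1 hz]

open Classical in
/-- The family on the vertices of the box whose box form pairs `g` with `cutFun u`: it carries `g`
at the vertex `0` and the functions `u i` at its neighbours. -/
noncomputable def cutBox (g : Z → ℝ) (u : κ → (κ → Z) → ℝ) (ω : κ → Fin 2) (z : κ → Z) : ℝ :=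
  (if ω = 0 then g (∑ i, z i) else 1) * ∏ i, if ω = Pi.single i 1 then u i z else 1

theorem boxForm_cutBox (g : Z → ℝ) {u : κ → (κ → Z) → ℝ} (hu : IsCutFamily u) :
    boxForm (cutBox g u) = 𝔼 x, g x * cutFun u x := by
  have hbox (z y : κ → Z) :
      ∏ ω, cutBox g u ω (boxVertex ω z y) = g (∑ i, z i) * ∏ i, u i z := by
    simp only [cutBox, prod_mul_distrib]
    congr 1
    · rw [Fintype.prod_ite_eq' (0 : κ → Fin 2) fun ω => g (∑ i, boxVertex ω z y i)]
      simp [boxVertex]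
    · rw [Finset.prod_comm]
      refine prod_congr rfl fun i _ => ?_
      rw [Fintype.prod_ite_eq' (Pi.single i 1 : κ → Fin 2) fun ω => u i (boxVertex ω z y)]
      refine hu.dependsOn i fun j hj => ?_
      rw [boxVertex, Pi.single_eq_of_ne hj, if_pos rfl]
  rw [expect_mul_cutFun, boxForm]
  simp only [hbox, Fintype.expect_const]

theorem abs_expect_mul_cutFun_le {u : κ → (κ → Z) → ℝ} (hu : IsCutFamily u) (g : Z → ℝ) :
    |𝔼 x, g x * cutFun u x| ≤ cubeNorm κ g := by
  refine le_of_pow_le_pow_left₀ (n := Fintype.card (κ → Fin 2)) Fintype.card_ne_zero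
    (cubeNorm_nonneg g) ?_
  have hzero : cutBox g u 0 = fun z => g (∑ i, z i) := by
    funext z
    simp [cutBox, eq_comm (a := (0 : κ → Fin 2))]
  have hone : ∀ ω ≠ 0, ∀ z, |cutBox g u ω z| ≤ 1 := by
    intro ω hω z
    rw [cutBox, if_neg hω, one_mul, abs_prod]
    refine prod_le_one (fun _ _ => abs_nonneg _) fun i _ => ?_
    split_ifs
    · exact hu.abs_le_one i z
    · exact abs_one.le
  rw [← boxForm_cutBox g hu]
  refine (abs_boxForm_pow_le_of_abs_le_one hone).trans_eq ?_
  rw [hzero, boxForm_comp_sum fun _ => g, abs_of_nonneg (cubeForm_const_nonneg g),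
    cubeNorm_pow_card]

theorem abs_expect_mul_le_of_mem_cutHull {φ : Z → ℝ} (hφ : φ ∈ cutHull κ Z) (g : Z → ℝ) :
    |𝔼 x, g x * φ x| ≤ cubeNorm κ g :=
  abs_le.2 (cutHull_subset
    ((convex_Icc (-cubeNorm κ g) (cubeNorm κ g)).is_linear_preimage (isLinearMap_expect_mul g))
    (isClosed_Icc.preimage (continuous_expect_mul g))
    (fun _ hu => abs_le.1 (abs_expect_mul_cutFun_le hu g)) hφ)

theorem cutHull_subset_Icc : cutHull κ Z ⊆ Set.Icc (-1) 1 := by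
  refine cutHull_subset (convex_Icc _ _) isClosed_Icc fun u hu => ?_
  have habs (x : Z) : |cutFun u x| ≤ 1 := by
    refine (abs_expect_le _ _).trans (expect_le (sumFiber_nonempty x) fun z _ => ?_)
    rw [abs_prod]
    exact prod_le_one (fun _ _ => abs_nonneg _) fun i _ => hu.abs_le_one i _
  exact ⟨fun x => (abs_le.1 (habs x)).1, fun x => (abs_le.1 (habs x)).2⟩

theorem one_mem_cutHull : (1 : Z → ℝ) ∈ cutHull κ Z := by
  have hone : cutFun (1 : κ → (κ → Z) → ℝ) = 1 := by
    funext x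
    simp [cutFun, expect_const (sumFiber_nonempty x)]
  exact hone ▸ cutFun_mem_cutHull ⟨by simp, fun _ _ _ _ => rfl⟩

theorem mul_mem_cutHull {φ ψ : Z → ℝ} (hφ : φ ∈ cutHull κ Z) (hψ : ψ ∈ cutHull κ Z) :
    φ * ψ ∈ cutHull κ Z := by
  refine mul_mem_closedConvexHull ?_ hφ hψ
  rintro _ ⟨u, hu, rfl⟩ _ ⟨v, hv, rfl⟩
  rw [cutFun_mul_cutFun]
  refine expect_mem_of_convex convex_closedConvexHull (sumFiber_nonempty 0) fun w _ =>
    cutFun_mem_cutHull ⟨fun i z => ?_, fun i z z' h => ?_⟩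
  · rw [abs_mul]
    exact mul_le_one₀ (hu.abs_le_one i z) (abs_nonneg _) (hv.abs_le_one i _)
  · exact congrArg₂ (· * ·) (hu.dependsOn i h)
      (hv.dependsOn i fun j hj => congrArg (· + w j) (h j hj))

theorem pow_mem_cutHull {φ : Z → ℝ} (hφ : φ ∈ cutHull κ Z) (n : ℕ) : φ ^ n ∈ cutHull κ Z := by
  induction n with
  | zero => exact pow_zero φ ▸ one_mem_cutHull
  | succ n ih => exact pow_succ φ n ▸ mul_mem_cutHull ih hφ

theorem cubeDual_mem_cutHull {g : (κ → Fin 2) → Z → ℝ} (hg : ∀ ω ≠ 0, ∀ x, |g ω x| ≤ 1) :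
    cubeDual g 0 ∈ cutHull κ Z := by
  have hex (ω : κ → Fin 2) : ∃ i, ω ≠ 0 → ω i = 1 := by
    by_contra! h
    obtain ⟨i⟩ := ‹Nonempty κ›
    refine (h i).1 (funext fun j => ?_)
    have hj := (h j).2
    simp only [Pi.zero_apply]
    omega
  choose dir hdir using hex
  let u (y : κ → Z) (i : κ) (z : κ → Z) : ℝ :=
    ∏ ω ∈ univ.erase 0 with dir ω = i, g ω (∑ j, boxVertex ω z y j)
  have hu (y) : IsCutFamily (u y) := by
    refine ⟨fun i z => ?_, fun i z z' h => prod_congr rfl fun ω hω => ?_⟩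
    · rw [abs_prod]
      exact prod_le_one (fun _ _ => abs_nonneg _)
        fun ω hω => hg ω (ne_of_mem_erase (mem_filter.1 hω).1) _
    · obtain ⟨hω0, rfl⟩ := mem_filter.1 hω
      congr 2
      funext j
      rcases eq_or_ne j (dir ω) with rfl | hj
      · simp [boxVertex, hdir ω (ne_of_mem_erase hω0)]
      · rw [boxVertex, boxVertex, h j hj]
  have hdual : cubeDual g 0 = 𝔼 y, cutFun (u y) := by
    funext x
    simp only [expect_apply, cutFun]
    rw [expect_comm, ← expect_const (sumFiber_nonempty (κ := κ) x) (cubeDual g 0 x)]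
    refine expect_congr rfl fun z hz => ?_
    refine Fintype.expect_equiv (Equiv.addLeft z) _ _ fun h => ?_
    rw [prod_fiberwise]
    simp [cubePoint, mem_sumFiber.1 hz, sum_boxVertex_add]
  rw [hdual]
  exact expect_mem_of_convex convex_closedConvexHull (univ_nonempty (α := κ → Z))
    fun y _ => cutFun_mem_cutHull (hu y)

end CutFunctions

section DenseModel

open Finset

theorem exists_forall_expect_sub_mul_le {Z : Type*} [Fintype Z] {K C : Set (Z → ℝ)}
    (hKne : K.Nonempty) (hK : Convex ℝ K) (hKc : IsCompact K)
    (hCne : C.Nonempty) (hC : Convex ℝ C) (hCc : IsCompact C) {f : Z → ℝ} {ε : ℝ}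
    (hex : ∀ φ ∈ C, ∃ h ∈ K, 𝔼 x, (f x - h x) * φ x ≤ ε) :
    ∃ h ∈ K, ∀ φ ∈ C, 𝔼 x, (f x - h x) * φ x ≤ ε := by
  have hcont : Continuous fun p : (Z → ℝ) × (Z → ℝ) => 𝔼 x, (f x - p.1 x) * p.2 x := by
    simp only [Fintype.expect_eq_sum_div_card]
    fun_prop
  have hconcave (h : Z → ℝ) : ConcaveOn ℝ C fun φ : Z → ℝ => 𝔼 x, (f x - h x) * φ x :=
    ((isLinearMap_expect_mul fun x => f x - h x).mk').concaveOn hC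
  have hconvex (φ : Z → ℝ) : ConvexOn ℝ K fun h : Z → ℝ => 𝔼 x, (f x - h x) * φ x := by
    refine ⟨hK, fun a _ b _ s t _ _ hst => le_of_eq ?_⟩
    simp only [smul_eq_mul, mul_expect, ← expect_add_distrib, Pi.add_apply, Pi.smul_apply]
    refine expect_congr rfl fun x _ => ?_
    obtain rfl : t = 1 - s := by linarith
    ring
  obtain ⟨h₀, hh₀, φ₀, hφ₀, hsaddle⟩ := Sion.exists_isSaddlePointOn
    (f := fun h φ : Z → ℝ => 𝔼 x, (f x - h x) * φ x) hKne hK hKc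
    (fun φ _ => (hcont.comp (by fun_prop : Continuous fun h : Z → ℝ =>
      (h, φ))).lowerSemicontinuous.lowerSemicontinuousOn _)
    (fun φ _ => (hconvex φ).quasiconvexOn) hC hCne hCc
    (fun h _ => (hcont.comp (by fun_prop : Continuous fun φ : Z → ℝ =>
      (h, φ))).upperSemicontinuous.upperSemicontinuousOn _)
    (fun h _ => (hconcave h).quasiconcaveOn)
  obtain ⟨h₁, hh₁, hle⟩ := hex φ₀ hφ₀
  exact ⟨h₀, hh₀, fun φ hφ => (hsaddle h₁ hh₁ φ hφ).trans hle⟩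

variable {κ : Type*} [Fintype κ] [DecidableEq κ] [Nonempty κ]

theorem isCompact_cutHull {Z : Type*} [AddCommGroup Z] [Fintype Z] : IsCompact (cutHull κ Z) :=
  isCompact_Icc.of_isClosed_subset isClosed_closedConvexHull cutHull_subset_Icc

theorem expect_le_cubeNorm {Z : Type*} [AddCommGroup Z] [Fintype Z] (g : Z → ℝ) :
    𝔼 x, g x ≤ cubeNorm κ g := by
  simpa using (le_abs_self _).trans (abs_expect_mul_le_of_mem_cutHull (κ := κ) one_mem_cutHull g)

theorem expect_mul_eval_le {Z : Type*} [AddCommGroup Z] [Fintype Z] {φ : Z → ℝ}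
    (hφ : φ ∈ cutHull κ Z) (g : Z → ℝ) (P : Polynomial ℝ) :
    𝔼 x, g x * P.eval (φ x) ≤ P.sum (fun _ c => |c|) * cubeNorm κ g := by
  calc 𝔼 x, g x * P.eval (φ x) = P.sum fun n c => c * 𝔼 x, g x * (φ ^ n) x := by
        simp only [Polynomial.eval_eq_sum, Polynomial.sum, mul_sum, mul_expect,
          mul_left_comm (g _), Pi.pow_apply]
        exact expect_sum_comm _ _ _
    _ ≤ P.sum (fun _ c => |c|) * cubeNorm κ g := by
        rw [Polynomial.sum, Polynomial.sum, sum_mul]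
        refine sum_le_sum fun n _ => (le_abs_self _).trans ?_
        rw [abs_mul]
        exact mul_le_mul_of_nonneg_left
          (abs_expect_mul_le_of_mem_cutHull (pow_mem_cutHull hφ n) g) (abs_nonneg _)

variable (κ) in
theorem exists_expect_mul_comp_le {k : ℝ → ℝ} (hk : ContinuousOn k (Set.Icc (-1) 1)) {ε : ℝ}
    (hε : 0 < ε) :
    ∃ δ > 0, ∀ (Z : Type*) [AddCommGroup Z] [Fintype Z] (ν : Z → ℝ), (∀ x, 0 ≤ ν x) →
      cubeNorm κ (ν - 1) ≤ δ → ∀ φ ∈ cutHull κ Z, 𝔼 x, (ν x - 1) * k (φ x) ≤ ε := by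
  obtain ⟨P, hP⟩ := exists_polynomial_near_of_continuousOn (-1) 1 k hk (ε / 6) (by positivity)
  set L : ℝ := P.sum fun _ c => |c|
  have hL : 0 ≤ L := sum_nonneg fun _ _ => abs_nonneg _
  refine ⟨min 1 (ε / (2 * (L + 1))), by positivity, fun Z _ _ ν hν hδ φ hφ => ?_⟩
  have hpoly : 𝔼 x, (ν x - 1) * P.eval (φ x) ≤ ε / 2 :=
    calc 𝔼 x, (ν x - 1) * P.eval (φ x) ≤ L * cubeNorm κ (ν - 1) := expect_mul_eval_le hφ (ν - 1) P
      _ ≤ (L + 1) * (ε / (2 * (L + 1))) :=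
          mul_le_mul (by linarith) (hδ.trans (min_le_right _ _)) (cubeNorm_nonneg _)
            (by positivity)
      _ = ε / 2 := by field_simp
  have hmass : 𝔼 x, (ν x + 1) ≤ 3 := by
    have hmean : 𝔼 x, (ν x - 1) ≤ 1 :=
      (expect_le_cubeNorm (κ := κ) (ν - 1)).trans (hδ.trans (min_le_left _ _))
    rw [expect_sub_distrib, Fintype.expect_const] at hmean
    rw [expect_add_distrib, Fintype.expect_const]
    linarith
  have happrox (x : Z) :
      (ν x - 1) * k (φ x) ≤ (ν x - 1) * P.eval (φ x) + (ν x + 1) * (ε / 6) := by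
    have hnear := hP (φ x) ⟨(cutHull_subset_Icc hφ).1 x, (cutHull_subset_Icc hφ).2 x⟩
    have hdiff : (ν x - 1) * (k (φ x) - P.eval (φ x)) ≤ (ν x + 1) * (ε / 6) := by
      refine (le_abs_self _).trans ?_
      rw [abs_mul, abs_sub_comm (k _)]
      exact mul_le_mul (abs_le.2 ⟨by linarith [hν x], by linarith⟩) hnear.le (abs_nonneg _)
        (by linarith [hν x])
    linarith
  calc 𝔼 x, (ν x - 1) * k (φ x)
      ≤ 𝔼 x, ((ν x - 1) * P.eval (φ x) + (ν x + 1) * (ε / 6)) :=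
        expect_le_expect fun x _ => happrox x
    _ = 𝔼 x, (ν x - 1) * P.eval (φ x) + (𝔼 x, (ν x + 1)) * (ε / 6) := by
        rw [expect_add_distrib, expect_mul]
    _ ≤ ε := by linarith [mul_le_mul_of_nonneg_right hmass (by positivity : 0 ≤ ε / 6)]

variable (κ) in
theorem exists_dense_model {a : ℝ} (ha : a < 1) {ε : ℝ} (hε : 0 < ε) :
    ∃ δ > 0, ∀ (Z : Type*) [AddCommGroup Z] [Fintype Z] (ν f : Z → ℝ),
      cubeNorm κ (ν - 1) ≤ δ → (∀ x, f x ∈ Set.Icc (a * ν x) (ν x)) →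
      ∃ h : Z → ℝ, (∀ x, h x ∈ Set.Icc a 1) ∧
        ∀ φ ∈ cutHull κ Z, 𝔼 x, (f x - h x) * φ x ≤ ε := by
  -- The largest value of `h φ` for `h ∈ [a, 1]` is `max φ (a φ)`, and that of `f φ` for
  -- `f ∈ [a ν, ν]` is `ν` times it; so minimax reduces the claim to a test against `ν - 1`.
  obtain ⟨δ, hδ, H⟩ := exists_expect_mul_comp_le κ
    (k := fun t => max t (a * t)) (by fun_prop) hε
  refine ⟨δ, hδ, fun Z _ _ ν f hνδ hf => ?_⟩
  have hν (x) : 0 ≤ ν x := by nlinarith [(hf x).1.trans (hf x).2]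
  obtain ⟨h, hh, hle⟩ := exists_forall_expect_sub_mul_le (K := Set.Icc (fun _ : Z => a) 1)
    (C := cutHull κ Z) (f := f) (ε := ε) ⟨1, fun _ => ha.le, le_rfl⟩ (convex_Icc _ _)
    isCompact_Icc ⟨1, one_mem_cutHull⟩ convex_closedConvexHull isCompact_cutHull fun φ hφ => by
      refine ⟨fun x => if 0 ≤ φ x then 1 else a,
        ⟨fun x => by dsimp only; split_ifs <;> linarith,
          fun x => by dsimp only [Pi.one_apply]; split_ifs <;> linarith⟩,
        (expect_le_expect fun x _ => ?_).trans (H Z ν hν hνδ φ hφ)⟩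
      dsimp only
      split_ifs with hx
      · rw [max_eq_left (by nlinarith)]
        exact mul_le_mul_of_nonneg_right (by linarith [(hf x).2]) hx
      · rw [max_eq_right (by nlinarith)]
        nlinarith [(hf x).1]
  exact ⟨h, fun x => ⟨hh.1 x, hh.2 x⟩, hle⟩

end DenseModel

section Truncation

open Finset

theorem sq_expect_mul_le_of_abs_le {α : Type*} [Fintype α] {w ν : α → ℝ}
    (hw : ∀ x, |w x| ≤ ν x) (D : α → ℝ) :
    (𝔼 x, w x * D x) ^ 2 ≤ (𝔼 x, ν x) * 𝔼 x, ν x * D x ^ 2 := by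
  have hν (x) : 0 ≤ ν x := (abs_nonneg _).trans (hw x)
  have hsqrt : |𝔼 x, w x * D x| ≤ 𝔼 x, √(ν x) * (√(ν x) * |D x|) := by
    refine (abs_expect_le _ _).trans (expect_le_expect fun x _ => ?_)
    rw [← mul_assoc, Real.mul_self_sqrt (hν x), abs_mul]
    exact mul_le_mul_of_nonneg_right (hw x) (abs_nonneg _)
  calc (𝔼 x, w x * D x) ^ 2 ≤ (𝔼 x, √(ν x) * (√(ν x) * |D x|)) ^ 2 :=
        sq_le_sq' (neg_le_of_abs_le hsqrt) (le_of_abs_le hsqrt)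
    _ ≤ (𝔼 x, √(ν x) ^ 2) * 𝔼 x, (√(ν x) * |D x|) ^ 2 := expect_mul_sq_le_sq_mul_sq _ _ _
    _ = (𝔼 x, ν x) * 𝔼 x, ν x * D x ^ 2 := by simp only [mul_pow, Real.sq_sqrt (hν _), sq_abs]

/-- The nearest point to `t` in the interval `[-1, 1]`. -/
noncomputable def clip (t : ℝ) : ℝ := max (-1) (min 1 t)

theorem abs_clip_le_one (t : ℝ) : |clip t| ≤ 1 :=
  abs_le.2 ⟨le_max_left _ _, max_le (by norm_num) (min_le_left _ _)⟩

theorem abs_sub_clip_le {t M : ℝ} (h : |t| ≤ M) : |t - clip t| ≤ |M - 1| := by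
  obtain ⟨hlower, hupper⟩ := abs_le.1 h
  have := le_abs_self (M - 1)
  have := abs_nonneg (M - 1)
  rw [clip, abs_le]
  grind

end Truncation

section Densification

open Finset Function

variable {κ ι Z : Type*} [Fintype κ] [DecidableEq κ] [Fintype ι] [DecidableEq ι] [Nonempty ι]
  [AddCommGroup Z] [Fintype Z] {η : ℝ} {w : Z → ℝ} {f m : (ι → Fin 2) → Z → ℝ}
  {f' m' : (κ → Fin 2) → Z → ℝ}

theorem abs_expect_mul_cubeDual_mul_cubeDual_sub_one_le (hw : cubeNorm (ι ⊕ κ) (w - 1) ≤ η)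
    (hm : ∀ ω, cubeNorm (ι ⊕ κ) (m ω - 1) ≤ η) (hm' : ∀ ω, cubeNorm (ι ⊕ κ) (m' ω - 1) ≤ η)
    (v : ι → Fin 2) (v' : κ → Fin 2) :
    |𝔼 x, w x * (cubeDual m v x * cubeDual m' v' x) - 1| ≤ linearFormsError (ι ⊕ κ) η := by
  rw [← cubeForm_glueFaces]
  refine abs_cubeForm_sub_one_le (glueFaces_cases (p := fun g => cubeNorm (ι ⊕ κ) (g - 1) ≤ η)
    hw hm hm' ?_)
  rw [sub_self, cubeNorm_zero]
  exact (cubeNorm_nonneg _).trans hw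

theorem abs_expect_mul_cubeDual_mul_cubeDual_le (hw : cubeNorm (ι ⊕ κ) w ≤ η)
    (hf : ∀ ω, cubeNorm (ι ⊕ κ) (f ω) ≤ 1 + η) (hf' : ∀ ω, cubeNorm (ι ⊕ κ) (f' ω) ≤ 1 + η)
    (v : ι → Fin 2) (v' : κ → Fin 2) :
    |𝔼 x, w x * (cubeDual f v x * cubeDual f' v' x)| ≤ linearFormsError (ι ⊕ κ) η := by
  have hη : 0 ≤ η := (cubeNorm_nonneg _).trans hw
  have hle : ∀ ω, cubeNorm (ι ⊕ κ) (glueFaces v v' w f f' ω) ≤ 1 + η :=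
    glueFaces_cases (p := fun g => cubeNorm (ι ⊕ κ) g ≤ 1 + η) (by linarith) hf hf'
      (by rw [cubeNorm_one]; linarith)
  have hvertex : glueFaces v v' w f f' (Sum.elim v v') = w := by simp [glueFaces]
  rw [← cubeForm_glueFaces]
  calc |cubeForm (glueFaces v v' w f f')|
      ≤ ∏ ω, cubeNorm (ι ⊕ κ) (glueFaces v v' w f f' ω) := abs_cubeForm_le_prod_cubeNorm _
    _ ≤ η * (1 + η) ^ (Fintype.card (ι ⊕ κ → Fin 2) - 1) := by
        rw [← mul_prod_erase _ _ (mem_univ (Sum.elim v v')), hvertex]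
        refine mul_le_mul hw ?_ (prod_nonneg fun _ _ => cubeNorm_nonneg _) hη
        exact (prod_le_prod (fun _ _ => cubeNorm_nonneg _) fun ω _ => hle ω).trans_eq (by simp)
    _ ≤ linearFormsError (ι ⊕ κ) η := by
        rw [linearFormsError, ← mul_pow_sub_one Fintype.card_ne_zero]
        linarith [one_le_pow₀ (n := Fintype.card (ι ⊕ κ → Fin 2) - 1) (by linarith : 1 ≤ 1 + η)]

theorem abs_expect_cubeDual_mul_cubeDual_sub_one_le (hm : ∀ ω, cubeNorm (ι ⊕ κ) (m ω - 1) ≤ η)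
    (hm' : ∀ ω, cubeNorm (ι ⊕ κ) (m' ω - 1) ≤ η) (v : ι → Fin 2) (v' : κ → Fin 2) :
    |𝔼 x, cubeDual m v x * cubeDual m' v' x - 1| ≤ linearFormsError (ι ⊕ κ) η := by
  have hone : cubeNorm (ι ⊕ κ) ((1 : Z → ℝ) - 1) ≤ η := by
    rw [sub_self, cubeNorm_zero]
    exact (cubeNorm_nonneg _).trans (hm v)
  simpa using abs_expect_mul_cubeDual_mul_cubeDual_sub_one_le hone hm hm' v v'

theorem expect_cubeDual_sub_one_sq_le (hm : ∀ ω, cubeNorm (ι ⊕ ι) (m ω - 1) ≤ η)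
    (v : ι → Fin 2) :
    𝔼 x, (cubeDual m v x - 1) ^ 2 ≤ 3 * linearFormsError (ι ⊕ ι) η := by
  have hone : ∀ ω, cubeNorm (ι ⊕ ι) ((1 : (ι → Fin 2) → Z → ℝ) ω - 1) ≤ η := fun ω => by
    rw [Pi.one_apply, sub_self, cubeNorm_zero]
    exact (cubeNorm_nonneg _).trans (hm v)
  have hfirst := abs_expect_cubeDual_mul_cubeDual_sub_one_le hm hone v v
  have hsecond := abs_expect_cubeDual_mul_cubeDual_sub_one_le hm hm v v
  simp only [cubeDual_one, Pi.one_apply, mul_one] at hfirst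
  calc 𝔼 x, (cubeDual m v x - 1) ^ 2
      = 𝔼 x, cubeDual m v x * cubeDual m v x - 2 * 𝔼 x, cubeDual m v x + 𝔼 _x : Z, (1 : ℝ) := by
        rw [mul_expect, ← expect_sub_distrib, ← expect_add_distrib]
        exact expect_congr rfl fun x _ => by ring
    _ ≤ 3 * linearFormsError (ι ⊕ ι) η := by
        rw [Fintype.expect_const]
        linarith [(abs_le.1 hfirst).1, (abs_le.1 hsecond).2]

theorem expect_sub_clip_cubeDual_mul_le (hm : ∀ ω, cubeNorm (ι ⊕ ι) (m ω - 1) ≤ η)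
    (hf : ∀ ω x, |f ω x| ≤ m ω x) (v : ι → Fin 2) :
    𝔼 x, (cubeDual f v x - clip (cubeDual f v x)) * cubeDual f v x ≤
      √(3 * linearFormsError (ι ⊕ ι) η * (1 + linearFormsError (ι ⊕ ι) η)) := by
  have hdual := abs_cubeDual_le_cubeDual (v := v) fun ω _ => hf ω
  have hsecond := (abs_le.1 (abs_expect_cubeDual_mul_cubeDual_sub_one_le hm hm v v)).2
  have hsq := expect_cubeDual_sub_one_sq_le hm v
  calc 𝔼 x, (cubeDual f v x - clip (cubeDual f v x)) * cubeDual f v x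
      ≤ 𝔼 x, |cubeDual m v x - 1| * cubeDual m v x := by
        refine expect_le_expect fun x _ => (le_abs_self _).trans ?_
        rw [abs_mul]
        exact mul_le_mul (abs_sub_clip_le (hdual x)) (hdual x) (abs_nonneg _) (abs_nonneg _)
    _ ≤ √((𝔼 x, |cubeDual m v x - 1| ^ 2) * 𝔼 x, cubeDual m v x ^ 2) :=
        Real.le_sqrt_of_sq_le (expect_mul_sq_le_sq_mul_sq _ _ _)
    _ ≤ √(3 * linearFormsError (ι ⊕ ι) η * (1 + linearFormsError (ι ⊕ ι) η)) := by
        simp only [sq_abs]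
        refine Real.sqrt_le_sqrt (mul_le_mul hsq ?_ (expect_nonneg fun _ _ => sq_nonneg _)
          ((expect_nonneg fun _ _ => sq_nonneg _).trans hsq))
        simp only [sq]
        linarith

/-- The bound that replacing one function of a cube form by its clipped dual function gives, where
`β` is the error in the linear forms condition and `t` bounds the new form. -/
noncomputable def densificationBound (β t : ℝ) : ℝ :=
  √((1 + β) * (β + √(3 * β * (1 + β)) + t))

theorem densificationBound_mono {β : ℝ} (hβ : 0 ≤ β) : Monotone (densificationBound β) :=
  fun _ _ h => Real.sqrt_le_sqrt (by gcongr)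

theorem tendsto_iterate_densificationBound (n : ℕ) :
    Tendsto (fun b => (densificationBound (linearFormsError κ b))^[n] b) (𝓝 0) (𝓝 0) := by
  have hcont : Continuous fun b => (densificationBound (linearFormsError κ b))^[n] b := by
    induction n with
    | zero => exact continuous_id
    | succ n ih =>
      simp only [iterate_succ_apply', densificationBound, linearFormsError]
      unfold densificationBound linearFormsError at ih
      fun_prop
  have hfixed : IsFixedPt (densificationBound (linearFormsError κ 0)) 0 := by
    simp [IsFixedPt, densificationBound, linearFormsError]
  simpa only [(hfixed.iterate n).eq] using hcont.tendsto 0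

theorem cubeForm_le_densificationBound (hm : ∀ ω, cubeNorm (ι ⊕ ι) (m ω - 1) ≤ η)
    (hf : ∀ ω x, |f ω x| ≤ m ω x) (v : ι → Fin 2) :
    cubeForm f ≤ densificationBound (linearFormsError (ι ⊕ ι) η)
      (cubeForm (update f v (clip ∘ cubeDual f v))) := by
  set β := linearFormsError (ι ⊕ ι) η
  have hη : 0 ≤ η := (cubeNorm_nonneg _).trans (hm v)
  have hβ : η ≤ β := le_linearFormsError hη
  have hmean : 𝔼 x, m v x ≤ 1 + β := by
    have h : 𝔼 x, (m v x - 1) ≤ η := (expect_le_cubeNorm (m v - 1)).trans (hm v)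
    rw [expect_sub_distrib, Fintype.expect_const] at h
    linarith
  have hnorm (ω) : cubeNorm (ι ⊕ ι) (f ω) ≤ 1 + η :=
    (cubeNorm_le_one_add_of_abs_le (hf ω)).trans (by linarith [hm ω])
  have hweight : 𝔼 x, (m v x - 1) * (cubeDual f v x * cubeDual f v x) ≤ β :=
    (abs_le.1 (abs_expect_mul_cubeDual_mul_cubeDual_le (hm v) hnorm hnorm v v)).2
  have hsq : 𝔼 x, m v x * cubeDual f v x ^ 2 ≤
      β + √(3 * β * (1 + β)) + cubeForm (update f v (clip ∘ cubeDual f v)) := by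
    calc 𝔼 x, m v x * cubeDual f v x ^ 2
        = 𝔼 x, (m v x - 1) * (cubeDual f v x * cubeDual f v x) +
            𝔼 x, (cubeDual f v x - clip (cubeDual f v x)) * cubeDual f v x +
            𝔼 x, clip (cubeDual f v x) * cubeDual f v x := by
          rw [← expect_add_distrib, ← expect_add_distrib]
          exact expect_congr rfl fun x _ => by ring
      _ ≤ _ := by
          rw [cubeForm_update]
          exact add_le_add_left (add_le_add hweight (expect_sub_clip_cubeDual_mul_le hm hf v)) _
  rw [cubeForm_eq_expect_mul_cubeDual f v]
  refine Real.le_sqrt_of_sq_le ((sq_expect_mul_le_of_abs_le (hf v) _).trans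
    (mul_le_mul hmean hsq (expect_nonneg fun x _ => ?_) (by linarith)))
  exact mul_nonneg ((abs_nonneg _).trans (hf v x)) (sq_nonneg _)

theorem cubeForm_le_iterate_densificationBound {ν f₀ : Z → ℝ} {b : ℝ} {v : ι → Fin 2}
    (hν : cubeNorm (ι ⊕ ι) (ν - 1) ≤ η)
    (hb : ∀ g : (ι → Fin 2) → Z → ℝ, g v = f₀ → (∀ ω ≠ v, ∀ x, |g ω x| ≤ 1) → cubeForm g ≤ b)
    {T : Finset (ι → Fin 2)} (hT : v ∉ T) (hv : f v = f₀)
    (hf : ∀ ω x, |f ω x| ≤ (insert v T).piecewise (fun _ => ν) 1 ω x) :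
    cubeForm f ≤ (densificationBound (linearFormsError (ι ⊕ ι) η))^[#T] b := by
  have hη : 0 ≤ η := (cubeNorm_nonneg _).trans hν
  have hm (S : Finset (ι → Fin 2)) (ω) :
      cubeNorm (ι ⊕ ι) (S.piecewise (fun _ => ν) 1 ω - 1) ≤ η := by
    by_cases hω : ω ∈ S
    · rwa [piecewise_eq_of_mem _ _ _ hω]
    · rwa [piecewise_eq_of_notMem _ _ _ hω, Pi.one_apply, sub_self, cubeNorm_zero]
  induction T using Finset.induction_on generalizing f with
  | empty =>
    refine hb f hv fun ω hω x => ?_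
    simpa [hω, Finset.piecewise] using hf ω x
  | insert ω₀ T hω₀ ih =>
    have hne : ω₀ ≠ v := fun h => hT (h ▸ mem_insert_self _ _)
    rw [card_insert_of_notMem hω₀, iterate_succ_apply']
    refine (cubeForm_le_densificationBound (hm _) hf ω₀).trans
      (densificationBound_mono (hη.trans (le_linearFormsError hη))
        (ih (fun h => hT (mem_insert_of_mem h)) ?_ fun ω x => ?_))
    · rw [update_of_ne hne.symm, hv]
    · rcases eq_or_ne ω ω₀ with rfl | hω
      · simpa [hne, hω₀] using abs_clip_le_one (cubeDual f ω x)
      · simpa [hω, Finset.piecewise] using hf ω x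

end Densification

section Transference

open Finset Function

variable {κ κ' : Type*} [Fintype κ] [DecidableEq κ] [Fintype κ'] [DecidableEq κ']

theorem cubeForm_le_of_forall_mem_cutHull [Nonempty κ] {Z : Type*} [AddCommGroup Z] [Fintype Z]
    {ν g : Z → ℝ} {η b : ℝ} (hν : cubeNorm (κ ⊕ κ) (ν - 1) ≤ η) (hg : ∀ x, |g x| ≤ ν x)
    (hb : ∀ φ ∈ cutHull κ Z, 𝔼 x, g x * φ x ≤ b) :
    cubeForm (fun _ : κ → Fin 2 => g) ≤
      (densificationBound (linearFormsError (κ ⊕ κ) η))^[#(univ.erase (0 : κ → Fin 2))] b := by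
  refine cubeForm_le_iterate_densificationBound (v := 0) (f₀ := g) hν (fun u hu hle => ?_)
    (notMem_erase _ _) rfl fun ω x => ?_
  · rw [cubeForm_eq_expect_mul_cubeDual u 0, hu]
    exact hb _ (cubeDual_mem_cutHull hle)
  · rw [insert_erase (mem_univ _), piecewise_univ]
    exact hg x

variable (κ) in
theorem exists_cubeNorm_sub_le [Nonempty κ] {a : ℝ} (ha : a ∈ Set.Ico (-1) 1) {ε : ℝ}
    (hε : 0 < ε) :
    ∃ δ > 0, ∀ (Z : Type*) [AddCommGroup Z] [Fintype Z] (ν f : Z → ℝ),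
      cubeNorm (κ ⊕ κ) (ν - 1) ≤ δ → (∀ x, f x ∈ Set.Icc (a * ν x) (ν x)) →
      ∃ h : Z → ℝ, (∀ x, h x ∈ Set.Icc a 1) ∧ cubeNorm κ (f - h) ≤ ε := by
  obtain ⟨b, hsmall, hb : 0 < b⟩ := ((((tendsto_iterate_densificationBound (κ := κ ⊕ κ)
    #(univ.erase (0 : κ → Fin 2))).mono_left nhdsWithin_le_nhds).eventually_lt_const
    (show 0 < (ε / 2) ^ Fintype.card (κ → Fin 2) by positivity)).and
    (self_mem_nhdsWithin (s := Set.Ioi 0))).exists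
  obtain ⟨δ, hδ, hmodel⟩ := exists_dense_model κ ha.2 (ε := 2 * b) (by positivity)
  refine ⟨min δ b, by positivity, fun Z _ _ ν f hνδ hf => ?_⟩
  obtain ⟨h, hh, hφ⟩ := hmodel Z ν f
    ((cubeNorm_le_cubeNorm_sum _).trans (hνδ.trans (min_le_left _ _))) hf
  refine ⟨h, hh, ?_⟩
  -- `f - h` is bounded by `ν + 1`, so half of it is bounded by a function still close to `1`.
  have hmean : cubeNorm (κ ⊕ κ) ((1 / 2 : ℝ) • (ν + 1) - 1) ≤ b := by
    have hcenter : (1 / 2 : ℝ) • (ν + 1) - 1 = (1 / 2 : ℝ) • (ν - 1) := by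
      funext x
      simp only [Pi.sub_apply, Pi.smul_apply, Pi.add_apply, Pi.one_apply, smul_eq_mul]
      ring
    rw [hcenter, cubeNorm_smul, abs_of_pos (by norm_num)]
    linarith [min_le_right δ b, cubeNorm_nonneg (κ := κ ⊕ κ) (ν - 1)]
  have hbound (x : Z) : |((1 / 2 : ℝ) • (f - h)) x| ≤ ((1 / 2 : ℝ) • (ν + 1)) x := by
    have hνx : 0 ≤ ν x := by nlinarith [(hf x).1, (hf x).2, ha.2]
    simp only [Pi.sub_apply, Pi.smul_apply, Pi.add_apply, Pi.one_apply, smul_eq_mul, abs_le]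
    constructor <;> nlinarith [(hf x).1, (hf x).2, (hh x).1, (hh x).2, ha.1]
  have hform := cubeForm_le_of_forall_mem_cutHull (b := b) hmean hbound fun φ hφmem => by
    have := hφ φ hφmem
    simp only [Pi.smul_apply, Pi.sub_apply, smul_eq_mul, mul_assoc, ← mul_expect]
    linarith
  have hhalf : cubeNorm κ ((1 / 2 : ℝ) • (f - h)) ≤ ε / 2 :=
    le_of_pow_le_pow_left₀ Fintype.card_ne_zero (by positivity)
      ((cubeNorm_pow_card _).trans_le (hform.trans hsmall.le))
  rw [cubeNorm_smul, abs_of_pos (by norm_num)] at hhalf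
  linarith

theorem cubeNorm_congr {Z : Type*} [AddCommGroup Z] [Fintype Z] (e : κ ≃ κ') (g : Z → ℝ) :
    cubeNorm κ g = cubeNorm κ' g := by
  rw [cubeNorm, cubeNorm, Fintype.card_congr (e.arrowCongr (Equiv.refl (Fin 2)))]
  congr 1
  refine Finset.expect_congr rfl fun x _ => ?_
  refine Fintype.expect_equiv (e.arrowCongr (Equiv.refl Z)) _ _ fun h => ?_
  refine Fintype.prod_equiv (e.arrowCongr (Equiv.refl (Fin 2))) _ _ fun ω => ?_
  refine congrArg (fun t => g (x + t)) (Fintype.sum_equiv e _ _ fun i => ?_)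
  simp [Equiv.arrowCongr]

theorem gowersNorm_eq_cubeNorm {Z : Type*} [AddCommGroup Z] [Fintype Z] (n : ℕ) (f : Z → ℝ) :
    gowersNorm n f = cubeNorm (Fin n) f := by
  rw [gowersNorm, cubeNorm, cubeForm, ← Finset.univ_product_univ, Finset.expect_product]
  simp [cubePoint]

theorem gowersNorm_two_mul {Z : Type*} [AddCommGroup Z] [Fintype Z] (n : ℕ) (f : Z → ℝ) :
    gowersNorm (2 * n) f = cubeNorm (Fin n ⊕ Fin n) f :=
  (gowersNorm_eq_cubeNorm _ f).trans
    (cubeNorm_congr ((finCongr (two_mul n)).trans finSumFinEquiv.symm) f)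

theorem exists_tendsto_rate {P : ℝ → ℝ → Prop} (hP : ∀ η > 0, ∃ ε > 0, P η ε)
    (hsmall : ∀ ε > 0, ∃ δ > 0, ∀ η > 0, η ≤ δ → P η ε) :
    ∃ F : ℝ → ℝ, Tendsto F (𝓝[>] 0) (𝓝 0) ∧ ∀ η > 0, ∃ ε ≤ F η, P η ε := by
  let S (η : ℝ) : Set ℝ := {ε | 0 < ε ∧ P η ε}
  have hbdd (η) : BddBelow (S η) := ⟨0, fun ε hε => hε.1.le⟩
  -- Adding `η` to the infimum makes it an upper bound for some admissible value.
  refine ⟨fun η => sInf (S η) + η, ?_, fun η hη => ?_⟩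
  · have hid : Tendsto (fun η : ℝ => η) (𝓝[>] 0) (𝓝 0) := nhdsWithin_le_nhds
    have hS : Tendsto (fun η => sInf (S η)) (𝓝[>] 0) (𝓝 0) := by
      refine tendsto_order.2 ⟨fun a ha => Eventually.of_forall fun η =>
        ha.trans_le (Real.sInf_nonneg fun ε hε => hε.1.le), fun a ha => ?_⟩
      obtain ⟨δ, hδ, H⟩ := hsmall (a / 2) (by positivity)
      filter_upwards [Ioc_mem_nhdsGT hδ] with η hη
      exact (csInf_le (hbdd η) ⟨by positivity, H η hη.1 hη.2⟩).trans_lt (half_lt_self ha)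
    simpa using hS.add hid
  · obtain ⟨ε, hε, hlt⟩ := exists_lt_of_csInf_lt (s := S η) (hP η hη)
      (lt_add_of_pos_right (sInf (S η)) hη)
    exact ⟨ε, hlt.le, hε.2⟩

theorem exists_gowersNorm_sub_le {s : ℕ} (hs : s ≠ 0) {ε : ℝ} (hε : 0 < ε) :
    ∃ δ > 0, ∀ (Z : Type*) [AddCommGroup Z] [Fintype Z] (ν f : Z → ℝ),
      gowersNorm (2 * s) (ν - 1) ≤ δ → (∀ x, |f x| ≤ ν x) →
      ∃ h : Z → ℝ, (∀ x, h x ∈ Set.Icc (-1 : ℝ) 1) ∧ gowersNorm s (f - h) ≤ ε ∧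
        ((∀ x, 0 ≤ f x) → ∀ x, 0 ≤ h x) := by
  have : NeZero s := ⟨hs⟩
  obtain ⟨δ, hδ, hsigned⟩ := exists_cubeNorm_sub_le (Fin s) (a := -1) (by norm_num) hε
  obtain ⟨δ', hδ', hnonneg⟩ := exists_cubeNorm_sub_le (Fin s) (a := 0) (by norm_num) hε
  refine ⟨min δ δ', by positivity, fun Z _ _ ν f hν hf => ?_⟩
  rw [gowersNorm_two_mul] at hν
  simp only [gowersNorm_eq_cubeNorm]
  by_cases hf0 : ∀ x, 0 ≤ f x
  · obtain ⟨h, hh, hle⟩ := hnonneg Z ν f (hν.trans (min_le_right _ _)) fun x =>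
      ⟨by simpa using hf0 x, (abs_le.1 (hf x)).2⟩
    exact ⟨h, fun x => ⟨by linarith [(hh x).1], (hh x).2⟩, hle, fun _ x => (hh x).1⟩
  · obtain ⟨h, hh, hle⟩ := hsigned Z ν f (hν.trans (min_le_left _ _)) fun x =>
      ⟨by simpa using (abs_le.1 (hf x)).1, (abs_le.1 (hf x)).2⟩
    exact ⟨h, hh, hle, fun hpos => absurd hpos hf0⟩

theorem gowersNorm_le_one_add {s : ℕ} (hs : s ≠ 0) {Z : Type*} [AddCommGroup Z] [Fintype Z]
    {ν f : Z → ℝ} (hf : ∀ x, |f x| ≤ ν x) :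
    gowersNorm s f ≤ 1 + gowersNorm (2 * s) (ν - 1) := by
  have : NeZero s := ⟨hs⟩
  rw [gowersNorm_eq_cubeNorm, gowersNorm_two_mul]
  exact (cubeNorm_le_one_add_of_abs_le hf).trans (by gcongr; exact cubeNorm_le_cubeNorm_sum _)

end Transference

theorem corollary4p4_general {s : ℕ} (hs : s ≠ 0) :
    ∃ F : ℝ → ℝ, Tendsto F (𝓝[>] 0) (𝓝 0) ∧
      ∀ (Z : Type*) [AddCommGroup Z] [Fintype Z] (η : ℝ), 0 < η →
        ∀ ν : Z → ℝ, gowersNorm (2 * s) (fun x => ν x - 1) ≤ η →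
          ∀ f : Z → ℝ, (∀ x, |f x| ≤ ν x) →
            ∃ h : Z → ℝ, (∀ x, h x ∈ Set.Icc (-1 : ℝ) 1) ∧
              gowersNorm s (fun x => f x - h x) ≤ F η ∧
              ((∀ x, 0 ≤ f x) → ∀ x, 0 ≤ h x) := by
  obtain ⟨F, hF, hrate⟩ := exists_tendsto_rate
    (P := fun η ε => ∀ (Z : Type _) [AddCommGroup Z] [Fintype Z] (ν : Z → ℝ),
      gowersNorm (2 * s) (fun x => ν x - 1) ≤ η → ∀ f : Z → ℝ, (∀ x, |f x| ≤ ν x) →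
        ∃ h : Z → ℝ, (∀ x, h x ∈ Set.Icc (-1 : ℝ) 1) ∧
          gowersNorm s (fun x => f x - h x) ≤ ε ∧ ((∀ x, 0 ≤ f x) → ∀ x, 0 ≤ h x))
    (fun η hη => ⟨1 + η, by positivity, fun Z _ _ ν hν f hf => ⟨0, by simp, by
      simpa using (gowersNorm_le_one_add hs hf).trans (add_le_add_right hν 1), fun _ _ => le_rfl⟩⟩)
    (fun ε hε => by
      obtain ⟨δ, hδ, H⟩ := exists_gowersNorm_sub_le hs hε
      exact ⟨δ, hδ, fun η _ hη Z _ _ ν hν f => H Z ν f (hν.trans hη)⟩)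
  refine ⟨F, hF, fun Z _ _ η hη ν hν f hf => ?_⟩
  obtain ⟨ε, hε, hP⟩ := hrate η hη
  obtain ⟨h, hh, hle, hpos⟩ := hP Z ν hν f hf
  exact ⟨h, hh, hle.trans hε, hpos⟩

theorem corollary4p4 (s : ℕ) (hs : 2 ≤ s) :
    ∃ F : ℝ → ℝ, Tendsto F (𝓝[>] 0) (𝓝 0) ∧
      ∀ (Z : Type*) [AddCommGroup Z] [Fintype Z] (η : ℝ), 0 < η → η ≤ 1 →
        ∀ ν : Z → ℝ, (∀ x, 0 ≤ ν x) → gowersNorm (2 * s) (fun x => ν x - 1) ≤ η →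
          ∀ f : Z → ℝ, (∀ x, |f x| ≤ ν x) →
            ∃ h : Z → ℝ, (∀ x, h x ∈ Set.Icc (-1 : ℝ) 1) ∧
              gowersNorm s (fun x => f x - h x) ≤ F η ∧
              ((∀ x, 0 ≤ f x) → ∀ x, 0 ≤ h x) := by
  obtain ⟨F, hF, H⟩ := corollary4p4_general (by omega : s ≠ 0)
  exact ⟨F, hF, fun Z _ _ η hη _ ν _ => H Z η hη ν⟩
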